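/- Let $\mathcal G=(V,\mathcal E)$ be a finite connected undirected graph without loops or multiple edges, let $\mathcal A$ be the set of its arcs (the two directions $v\to w$ and $w\to v$ of every edge), let $k$ be a field and consider the polynomial ring $k[P_a : a\in\mathcal A]$. For a trajectory $\omega=v_0v_1\cdots v_n$ of $\mathcal G$ (consecutive vertices are adjacent) let $r\omega=v_n\cdots v_1v_0$ be the reversed trajectory, and put $P^\omega=\prod_{a\in\mathcal A}P_a^{N_a(\omega)}$, where $N_a(\omega)$ is the number of times that $\omega$ traverses the arc $a$. A trajectory is closed if $v_n=v_0$. A cycle is a closed trajectory with $n\ge 1$ that meets no vertex twice, except that $v_n=v_0$, considered up to the choice of its initial vertex (which does not affect $P^\omega$ and $P^{r\omega}$). The K-ideal (Kolmogorov ideal) of $\mathcal G$ is the ideal of $k[P_a : a\in\mathcal A]$ generated by the binomials $P^\omega-P^{r\omega}$, where $\omega$ runs over all closed trajectories. Then: 1. The K-ideal is generated by the binomials $P^\omega-P^{r\omega}$, where $\omega$ is a cycle. 2. The binomials $P^\omega-P^{r\omega}$, where $\omega$ is a cycle, form a universal Gröbner basis of the K-ideal, that is, a Gröbner basis with respect to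 every monomial order; and this universal Gröbner basis is reduced up to signs and zero: for every monomial order $\prec$, the set of the binomials $P^\omega-P^{r\omega}$, where $\omega$ is a cycle with $P^{r\omega}\prec P^\omega$, is the reduced Gröbner basis of the K-ideal with respect to $\prec$. -/

import Mathlib

universe u v w

namespace KolmogorovIdeal

open MvPolynomial

noncomputable section

variable {V : Type u} {G : SimpleGraph V}

/-- The transition count `N(ω)` of a trajectory `ω` of the graph `G`: the exponent vector, indexed
by the arcs of `G` (the two directions `v → w`, `w → v` of each edge), whose entry at an arc `a`
is the number of times `ω` traverses `a`. -/
def transitionCount {x y : V} (ω : G.Walk x y) : G.Dart →₀ ℕ :=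
  (ω.darts.map fun a => Finsupp.single a 1).sum

theorem transitionCount_apply [DecidableEq G.Dart] {x y : V} (ω : G.Walk x y) (a : G.Dart) :
    transitionCount ω a = ω.darts.count a := by
  unfold transitionCount
  induction ω.darts with
  | nil => simp
  | cons b l ih =>
    simp only [List.map_cons, List.sum_cons, Finsupp.add_apply, ih, List.count_cons,
      Finsupp.single_apply, beq_iff_eq]
    exact Nat.add_comm _ _

/-- The monomial `P^ω = ∏ₐ Pₐ ^ Nₐ(ω)` in the polynomial ring `k[Pₐ : a an arc of G]`. -/
def pathMonomial (k : Type v) [Field k] {x y : V} (ω : G.Walk x y) : MvPolynomial G.Dart k :=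
  monomial (transitionCount ω) 1

/-- The binomial `P^ω - P^{rω}` of a trajectory `ω`, where `rω` is the reversed trajectory. -/
def binomial (k : Type v) [Field k] {x y : V} (ω : G.Walk x y) : MvPolynomial G.Dart k :=
  pathMonomial k ω - pathMonomial k ω.reverse

/-- The K-ideal of `G`: the ideal generated by the binomials `P^ω - P^{rω}`, where `ω` is any
closed trajectory of `G`. -/
def kIdeal (k : Type v) [Field k] (G : SimpleGraph V) : Ideal (MvPolynomial G.Dart k) :=
  Ideal.span {f | ∃ (x : V) (ω : G.Walk x x), f = binomial k ω}

/-- A closed trajectory is elementary if it has at least one transition and meets no vertex twice,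
except that it returns to its initial vertex at the end. A cycle is an elementary closed
trajectory up to the choice of the initial vertex; the choice does not affect `P^ω`.
Going back and forth along one edge is elementary; its binomial is `0`. -/
def IsElementary {x : V} (ω : G.Walk x x) : Prop :=
  ω.length ≠ 0 ∧ ω.support.tail.Nodup

/-- The set of all binomials `P^ω - P^{rω}`, where `ω` is a cycle of `G`. -/
def cycleBinomials (k : Type v) [Field k] (G : SimpleGraph V) : Set (MvPolynomial G.Dart k) :=
  {f | ∃ (x : V) (ω : G.Walk x x), IsElementary ω ∧ f = binomial k ω}

/-- The cycle binomials `P^ω - P^{rω}` with leading monomial `P^ω`. Since `ω` and `rω` have opposite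
binomials, this picks from each pair of opposite non-zero cycle binomials the one that is monic with
respect to the given monomial order. -/
def orientedCycleBinomials (k : Type v) [Field k] (G : SimpleGraph V)
    (m : MonomialOrder.{u, w} G.Dart) : Set (MvPolynomial G.Dart k) :=
  {f | ∃ (x : V) (ω : G.Walk x x), IsElementary ω ∧
    m.toSyn (transitionCount ω.reverse) < m.toSyn (transitionCount ω) ∧ f = binomial k ω}

/-- `B` is a Gröbner basis of the ideal `I` with respect to the monomial order `m`: it is a finite
subset of `I` whose leading terms generate the ideal of all leading terms of `I`.
(The leading term of `0` is `0`.) -/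
def IsGroebnerBasis {σ : Type u} {k : Type v} [Field k] (m : MonomialOrder.{u, w} σ)
    (B : Set (MvPolynomial σ k)) (I : Ideal (MvPolynomial σ k)) : Prop :=
  B.Finite ∧ B ⊆ (I : Set (MvPolynomial σ k)) ∧
    Ideal.span (m.leadingTerm '' B) = Ideal.span (m.leadingTerm '' (I : Set (MvPolynomial σ k)))

/-- `B` is the reduced Gröbner basis of the ideal `I` with respect to the monomial order `m`: it is
a Gröbner basis, its elements are monic, and no monomial that occurs in an element `f` of `B` is
divisible by the leading monomial of another element of `B`. -/
def IsReducedGroebnerBasis {σ : Type u} {k : Type v} [Field k] (m : MonomialOrder.{u, w} σ)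
    (B : Set (MvPolynomial σ k)) (I : Ideal (MvPolynomial σ k)) : Prop :=
  IsGroebnerBasis m B I ∧ (∀ f ∈ B, m.leadingCoeff f = 1) ∧
    ∀ f ∈ B, ∀ g ∈ B, g ≠ f → ∀ c ∈ f.support, ¬ m.degree g ≤ c

end

end KolmogorovIdeal

/-!
The K-ideal is homogeneous for the grading of the polynomial ring by `circulationDegree`, which
records how often a monomial uses each edge and how often it leaves each vertex: reversing a closed
walk changes neither. The differences of exponent vectors of equal degree are exactly the
antisymmetric circulations on the arcs, and such a circulation is a conformal sum of cycles
`N(ω) - N(rω)`: its positive arcs contain a cycle (`exists_isElementary`), which can be split off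
without producing new positive arcs (`exists_isElementary_reversal`).

Splitting off the cycles one by one shows that monomials of equal degree are congruent modulo the
cycle binomials, so these generate the K-ideal (`kIdeal_eq_span_cycleBinomials`).

For the Gröbner basis, let `f` be a nonzero element of the K-ideal with leading exponent `u`. The
coefficients of `f` in each degree sum to zero, so `f` has another exponent `v` of the same degree
(`exists_mem_support_ne_of_mem_span`), and `v` is smaller than `u`. In the decomposition of `u - v`
some cycle `ω` must then be larger than its reverse (`exists_isElementary_toSyn_lt`). Since `N(ω)`
is at most the positive part of `u - v`, the leading term of `f` is divisible by that of the
binomial of `ω`.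

The basis is reduced because cycles are minimal: a nonempty closed walk whose exponents are bounded
by those of a cycle has the same exponents (`IsElementary.transitionCount_eq_of_le`).
-/

namespace KolmogorovIdeal

open MvPolynomial SimpleGraph

noncomputable section

variable {V : Type u} {G : SimpleGraph V}

/-! ### Transition counts of walks -/

theorem transitionCount_cons {x y z : V} (h : G.Adj x y) (ω : G.Walk y z) :
    transitionCount (Walk.cons h ω) = Finsupp.single ⟨(x, y), h⟩ 1 + transitionCount ω := by
  simp [transitionCount]

theorem transitionCount_reverse_apply {x y : V} (ω : G.Walk x y) (a : G.Dart) :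
    transitionCount ω.reverse a = transitionCount ω a.symm := by
  classical
  rw [transitionCount_apply, transitionCount_apply, Walk.darts_reverse, List.count_reverse,
    ← List.count_map_of_injective _ _ Dart.symm_involutive.injective a.symm, Dart.symm_symm]

theorem transitionCount_le_iff_of_nodup {x y : V} {ω : G.Walk x y} (h : ω.darts.Nodup)
    {u : G.Dart →₀ ℕ} : transitionCount ω ≤ u ↔ ∀ a ∈ ω.darts, 0 < u a := by
  classical
  refine ⟨fun hle a ha => ?_, fun hpos a => ?_⟩
  · have := hle a
    rw [transitionCount_apply] at this
    exact (List.count_pos_iff.2 ha).trans_le this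
  · rw [transitionCount_apply]
    by_cases ha : a ∈ ω.darts
    · exact (List.nodup_iff_count_le_one.1 h a).trans (hpos a ha)
    · simp [List.count_eq_zero_of_not_mem ha]

theorem transitionCount_pos_iff {x y : V} {ω : G.Walk x y} {a : G.Dart} :
    0 < transitionCount ω a ↔ a ∈ ω.darts := by
  classical
  rw [transitionCount_apply, List.count_pos_iff]

theorem IsElementary.darts_nodup {x : V} {ω : G.Walk x x} (h : IsElementary ω) :
    ω.darts.Nodup := by
  have := h.2
  rw [← Walk.map_snd_darts] at this
  exact this.of_map

/-! ### The grading by edges and vertices -/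

/-- The degree of an exponent vector `u`: how often `u` uses the edge of each arc, in either
direction, and how often it leaves each vertex. Two exponent vectors have the same degree if and
only if their difference is an antisymmetric circulation on the arcs. -/
def circulationDegree (G : SimpleGraph V) :
    (G.Dart →₀ ℕ) →+ (G.Dart →₀ ℕ) × (V →₀ ℕ) :=
  (AddMonoidHom.id _ + Finsupp.mapDomain.addMonoidHom Dart.symm).prod
    (Finsupp.mapDomain.addMonoidHom fun a => a.fst)

theorem mapDomain_symm_transitionCount {x y : V} (ω : G.Walk x y) :
    Finsupp.mapDomain Dart.symm (transitionCount ω) = transitionCount ω.reverse := by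
  ext a
  rw [transitionCount_reverse_apply]
  conv_lhs => rw [← a.symm_symm]
  exact Finsupp.mapDomain_apply Dart.symm_involutive.injective _ _

theorem mapDomain_fst_transitionCount_add {x y : V} (ω : G.Walk x y) :
    Finsupp.mapDomain (fun a : G.Dart => a.fst) (transitionCount ω) + Finsupp.single y 1 =
      Finsupp.mapDomain (fun a : G.Dart => a.snd) (transitionCount ω) + Finsupp.single x 1 := by
  induction ω with
  | nil => rfl
  | cons h ω ih =>
    rw [transitionCount_cons, Finsupp.mapDomain_add, Finsupp.mapDomain_add,
      Finsupp.mapDomain_single, Finsupp.mapDomain_single, add_assoc, ih]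
    abel

/-- Reversing a closed walk does not change its degree. -/
theorem circulationDegree_transitionCount_reverse {x : V} (ω : G.Walk x x) :
    circulationDegree G (transitionCount ω.reverse) =
      circulationDegree G (transitionCount ω) := by
  refine Prod.ext ?_ ?_
  · change transitionCount ω.reverse + Finsupp.mapDomain _ _ =
      transitionCount ω + Finsupp.mapDomain _ _
    rw [mapDomain_symm_transitionCount, mapDomain_symm_transitionCount, Walk.reverse_reverse,
      add_comm]
  · change Finsupp.mapDomain _ _ = Finsupp.mapDomain _ _
    rw [← mapDomain_symm_transitionCount, ← Finsupp.mapDomain_comp]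
    exact (add_right_cancel (mapDomain_fst_transitionCount_add ω)).symm

theorem add_symm_eq_of_circulationDegree_eq {u v : G.Dart →₀ ℕ}
    (h : circulationDegree G u = circulationDegree G v) (a : G.Dart) :
    u a + u a.symm = v a + v a.symm := by
  have key : ∀ w : G.Dart →₀ ℕ, (circulationDegree G w).1 a = w a + w a.symm := fun w => by
    change w a + Finsupp.mapDomain Dart.symm w a = _
    congr 1
    conv_lhs => rw [← a.symm_symm]
    exact Finsupp.mapDomain_apply Dart.symm_involutive.injective _ _
  rw [← key, ← key, h]

/-- If `u` and `v` have the same degree, then every arc on which `u` exceeds `v` is preceded by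
another such arc: conservation at the common vertex gives an outgoing arc on which `v` exceeds `u`,
and antisymmetry turns it into an incoming arc on which `u` exceeds `v`. -/
theorem exists_lt_snd_eq_fst [Finite V] {u v : G.Dart →₀ ℕ}
    (h : circulationDegree G u = circulationDegree G v) {a : G.Dart} (ha : v a < u a) :
    ∃ b : G.Dart, v b < u b ∧ b.snd = a.fst := by
  classical
  have : Fintype V := Fintype.ofFinite V
  have key : ∀ w : G.Dart →₀ ℕ, (circulationDegree G w).2 a.fst =
      ∑ b : G.Dart with b.fst = a.fst, w b := fun w => by
    change Finsupp.mapDomain (fun a : G.Dart => a.fst) w a.fst = _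
    rw [Finsupp.mapDomain, Finsupp.sum_apply, Finsupp.sum_fintype _ _ (by simp),
      Finset.sum_filter]
    simp [Finsupp.single_apply]
  have hsum : ∑ b : G.Dart with b.fst = a.fst, u b = ∑ b : G.Dart with b.fst = a.fst, v b := by
    rw [← key, ← key, h]
  obtain ⟨b, hb, hlt⟩ : ∃ b ∈ Finset.univ.filter (fun b : G.Dart => b.fst = a.fst),
      u b < v b := by
    by_contra! hle
    exact (Finset.sum_lt_sum hle ⟨a, by simp, ha⟩).ne hsum.symm
  refine ⟨b.symm, ?_, by simpa using hb⟩
  have := add_symm_eq_of_circulationDegree_eq h b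
  omega

/-! ### Cycles inside a circulation -/

/-- In a finite graph, a nonempty set of arcs each of which is preceded by an arc of the set
contains an elementary closed walk: extend a path backwards until it meets itself. -/
theorem exists_isElementary [Finite V] {p : G.Dart → Prop} (hne : ∃ a, p a)
    (hp : ∀ a, p a → ∃ b, p b ∧ b.snd = a.fst) :
    ∃ (x : V) (ω : G.Walk x x), IsElementary ω ∧ ∀ a ∈ ω.darts, p a := by
  classical
  have : Fintype V := Fintype.ofFinite V
  by_contra hno
  have paths : ∀ n : ℕ, ∃ (x y : V) (q : G.Walk x y),
      q.IsPath ∧ q.length = n + 1 ∧ ∀ a ∈ q.darts, p a := by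
    intro n
    induction n with
    | zero =>
      obtain ⟨a, ha⟩ := hne
      refine ⟨a.fst, a.snd, Walk.cons a.adj Walk.nil, ?_, rfl, ?_⟩
      · simp
      · simpa using ha
    | succ n ih =>
      obtain ⟨x, y, q, hq, hlen, hdarts⟩ := ih
      obtain ⟨b, hb, hbx⟩ : ∃ b, p b ∧ b.snd = x := by
        cases q with
        | nil => simp at hlen
        | cons hadj q => exact hp ⟨(x, _), hadj⟩ (hdarts _ (by simp))
      subst hbx
      have hcons : ∀ {z : V} (r : G.Walk b.snd z), r.darts ⊆ q.darts →
          ∀ a ∈ (Walk.cons b.adj r).darts, p a := by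
        intro z r hr a ha
        rw [Walk.darts_cons, List.mem_cons] at ha
        rcases ha with rfl | ha
        · exact hb
        · exact hdarts a (hr ha)
      by_cases hmem : b.fst ∈ q.support
      · exact (hno ⟨b.fst, Walk.cons b.adj (q.takeUntil b.fst hmem),
          ⟨by simp, by simpa using (hq.takeUntil hmem).support_nodup⟩,
          hcons _ (q.darts_takeUntil_subset_darts hmem)⟩).elim
      · exact ⟨b.fst, y, Walk.cons b.adj q, (Walk.cons_isPath_iff _ _).2 ⟨hq, hmem⟩,
          by simp [hlen], hcons q (List.Subset.refl _)⟩
  obtain ⟨x, y, q, hq, hlen, -⟩ := paths (Fintype.card V)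
  have := hq.length_lt
  omega

/-- Distinct exponent vectors of the same degree differ, on the arcs where the first one is larger,
by at least an elementary closed walk. -/
theorem exists_isElementary_transitionCount_le_sub [Finite V] {u v : G.Dart →₀ ℕ}
    (h : circulationDegree G u = circulationDegree G v) (hne : u ≠ v) :
    ∃ (x : V) (ω : G.Walk x x), IsElementary ω ∧ transitionCount ω ≤ u - v := by
  obtain ⟨x, ω, hω, hpos⟩ := exists_isElementary (G := G) (p := fun a => v a < u a)
    (by
      by_contra! hle
      refine hne (Finsupp.ext fun a => ?_)
      have := add_symm_eq_of_circulationDegree_eq h a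
      have := hle a
      have := hle a.symm
      omega)
    fun a ha => exists_lt_snd_eq_fst h ha
  refine ⟨x, ω, hω, (transitionCount_le_iff_of_nodup hω.darts_nodup).2 fun a ha => ?_⟩
  simpa using hpos a ha

/-- One step of the conformal decomposition of `u - v` into cycles: reversing a cycle `ω` inside
`u - v` moves `u` closer to `v`, without leaving the degree. -/
theorem exists_isElementary_reversal [Finite V] {u v : G.Dart →₀ ℕ}
    (h : circulationDegree G u = circulationDegree G v) (hne : u ≠ v) :
    ∃ (x : V) (ω : G.Walk x x) (w : G.Dart →₀ ℕ), IsElementary ω ∧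
      transitionCount ω ≤ u - v ∧ u = w + transitionCount ω ∧
      circulationDegree G (w + transitionCount ω.reverse) = circulationDegree G v ∧
      w + transitionCount ω.reverse - v < u - v := by
  obtain ⟨x, ω, hω, hle⟩ := exists_isElementary_transitionCount_le_sub h hne
  obtain ⟨w, rfl⟩ : ∃ w, u = w + transitionCount ω :=
    ⟨u - transitionCount ω, (tsub_add_cancel_of_le (hle.trans tsub_le_self)).symm⟩
  -- The reverses of the arcs of `ω` gain at most what `u` lacks there, so no new excess appears.
  have hsub :
      w + transitionCount ω.reverse - v ≤ w + transitionCount ω - v - transitionCount ω := by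
    intro a
    have h1 := hle a
    have h2 := hle a.symm
    have h3 := add_symm_eq_of_circulationDegree_eq h a
    simp only [Finsupp.tsub_apply, Finsupp.add_apply, transitionCount_reverse_apply] at h1 h2 h3 ⊢
    omega
  refine ⟨x, ω, w, hω, hle, rfl, ?_, lt_of_le_of_lt hsub ?_⟩
  · rw [← h, map_add, map_add, circulationDegree_transitionCount_reverse]
  · refine tsub_le_self.lt_of_ne fun heq => ?_
    obtain ⟨a, ha⟩ : ∃ a, a ∈ ω.darts :=
      List.exists_mem_of_length_pos (by rw [Walk.length_darts]; exact Nat.pos_of_ne_zero hω.1)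
    have h1 := transitionCount_pos_iff.2 ha
    have h2 := hle a
    have h3 := DFunLike.congr_fun heq a
    simp only [Finsupp.tsub_apply, Finsupp.add_apply] at h2 h3
    omega

/-- Two exponent vectors of the same degree have congruent monomials modulo the cycle binomials. -/
theorem monomial_sub_monomial_mem_span_cycleBinomials [Finite V] (k : Type v) [Field k]
    {u v : G.Dart →₀ ℕ} (h : circulationDegree G u = circulationDegree G v) :
    monomial u (1 : k) - monomial v 1 ∈ Ideal.span (cycleBinomials k G) := by
  generalize hd : u - v = d
  induction d using WellFoundedLT.induction generalizing u with
  | ind d ih =>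
    by_cases hne : u = v
    · simp [hne]
    obtain ⟨x, ω, w, hω, -, rfl, hdeg, hlt⟩ := exists_isElementary_reversal h hne
    have h1 : monomial w (1 : k) * binomial k ω ∈ Ideal.span (cycleBinomials k G) :=
      Ideal.mul_mem_left _ _ (Ideal.subset_span ⟨x, ω, hω, rfl⟩)
    have h2 := ih _ (hd ▸ hlt) hdeg rfl
    have := Ideal.add_mem _ h1 h2
    simpa [binomial, pathMonomial, mul_sub, monomial_mul] using this

/-- If `u` and `v` have the same degree and `u` is larger, then some cycle inside `u - v` is larger
than its reverse: otherwise reversing the cycles one after the other would lead from `u` to `v`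
without ever going down. -/
theorem exists_isElementary_toSyn_lt [Finite V] (m : MonomialOrder.{u, w} G.Dart)
    {u v : G.Dart →₀ ℕ} (h : circulationDegree G u = circulationDegree G v)
    (hlt : m.toSyn v < m.toSyn u) :
    ∃ (x : V) (ω : G.Walk x x), IsElementary ω ∧
      m.toSyn (transitionCount ω.reverse) < m.toSyn (transitionCount ω) ∧
      transitionCount ω ≤ u - v := by
  generalize hd : u - v = d
  induction d using WellFoundedLT.induction generalizing u with
  | ind d ih =>
    obtain ⟨x, ω, w, hω, hle, rfl, hdeg, hsub⟩ :=
      exists_isElementary_reversal h (by rintro rfl; exact hlt.false)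
    rw [hd] at hsub hle
    by_cases hrev : m.toSyn (transitionCount ω.reverse) < m.toSyn (transitionCount ω)
    · exact ⟨x, ω, hω, hrev, hle⟩
    · have hlt' : m.toSyn v < m.toSyn (w + transitionCount ω.reverse) := by
        refine hlt.trans_le ?_
        rw [map_add, map_add]
        gcongr
        exact not_lt.1 hrev
      obtain ⟨y, ω', hω', hrev', hle'⟩ := ih _ hsub hdeg hlt' rfl
      exact ⟨y, ω', hω', hrev', hle'.trans hsub.le⟩

/-! ### Homogeneity of the K-ideal -/

/-- Let `I` be generated by differences of monomials of equal degree, for an arbitrary additive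
degree map `T`. Then no polynomial in `I` has a term which is alone in its degree, since the ring
homomorphism to the monoid algebra induced by `T` kills `I`. -/
theorem exists_mem_support_ne_of_mem_span {σ M R : Type*} [CommRing R] [AddCommMonoid M]
    (T : (σ →₀ ℕ) →+ M) {S : Set (MvPolynomial σ R)}
    (hS : ∀ f ∈ S, ∃ u v, T u = T v ∧ f = monomial u 1 - monomial v 1)
    {f : MvPolynomial σ R} (hf : f ∈ Ideal.span S) {u : σ →₀ ℕ} (hu : u ∈ f.support) :
    ∃ v ∈ f.support, v ≠ u ∧ T u = T v := by
  let φ : MvPolynomial σ R →+* AddMonoidAlgebra R M :=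
    AddMonoidAlgebra.mapDomainRingHom R T
  have hφ : ∀ v c, φ (monomial v c) = AddMonoidAlgebra.single (T v) c := fun v c =>
    AddMonoidAlgebra.mapDomain_single
  have hker : Ideal.span S ≤ RingHom.ker φ := by
    refine Ideal.span_le.2 fun g hg => ?_
    obtain ⟨v, w, hvw, rfl⟩ := hS g hg
    simp [RingHom.mem_ker, hφ, hvw]
  have hzero : φ f = 0 := hker hf
  by_contra! hno
  rw [f.as_sum, map_sum] at hzero
  have hcoeff := DFunLike.congr_fun (congrArg AddMonoidAlgebra.coeff hzero) (T u)
  rw [AddMonoidAlgebra.coeff_sum, Finsupp.finsetSum_apply, Finset.sum_eq_single u] at hcoeff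
  · exact mem_support_iff.1 hu (by simpa [hφ] using hcoeff)
  · intro v hv hvu
    simp [hφ, Finsupp.single_eq_of_ne (hno v hv hvu)]
  · exact fun h => (h hu).elim

theorem exists_mem_support_ne_of_mem_kIdeal {k : Type v} [Field k] {f : MvPolynomial G.Dart k}
    (hf : f ∈ kIdeal k G) {u : G.Dart →₀ ℕ} (hu : u ∈ f.support) :
    ∃ v ∈ f.support, v ≠ u ∧ circulationDegree G u = circulationDegree G v := by
  refine exists_mem_support_ne_of_mem_span _ ?_ hf hu
  rintro _ ⟨x, ω, rfl⟩
  exact ⟨_, _, (circulationDegree_transitionCount_reverse ω).symm, rfl⟩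

theorem cycleBinomials_subset_kIdeal (k : Type v) [Field k] :
    cycleBinomials k G ⊆ (kIdeal k G : Set (MvPolynomial G.Dart k)) := by
  rintro _ ⟨x, ω, -, rfl⟩
  exact Ideal.subset_span ⟨x, ω, rfl⟩

theorem kIdeal_eq_span_cycleBinomials [Finite V] (k : Type v) [Field k] :
    kIdeal k G = Ideal.span (cycleBinomials k G) := by
  refine le_antisymm (Ideal.span_le.2 ?_) (Ideal.span_le.2 (cycleBinomials_subset_kIdeal k))
  rintro _ ⟨x, ω, rfl⟩
  exact monomial_sub_monomial_mem_span_cycleBinomials k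
    (circulationDegree_transitionCount_reverse ω).symm

/-! ### Gröbner bases -/

theorem orientedCycleBinomials_subset_cycleBinomials (k : Type v) [Field k]
    (m : MonomialOrder.{u, w} G.Dart) : orientedCycleBinomials k G m ⊆ cycleBinomials k G := by
  rintro _ ⟨x, ω, hω, -, rfl⟩
  exact ⟨x, ω, hω, rfl⟩

/-- There are finitely many cycle binomials, since their exponents are at most `1`. -/
theorem finite_cycleBinomials [Finite V] (k : Type v) [Field k] (G : SimpleGraph V) :
    (cycleBinomials k G).Finite := by
  classical
  have : Fintype V := Fintype.ofFinite V
  let one : G.Dart →₀ ℕ := Finsupp.equivFunOnFinite.symm 1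
  refine (((Set.finite_Iic one).prod (Set.finite_Iic one)).image
    fun p => monomial p.1 (1 : k) - monomial p.2 1).subset ?_
  rintro _ ⟨x, ω, hω, rfl⟩
  have hle : transitionCount ω ≤ one :=
    (transitionCount_le_iff_of_nodup hω.darts_nodup).2 fun a _ => Nat.one_pos
  refine ⟨(transitionCount ω, transitionCount ω.reverse), ⟨hle, fun a => ?_⟩, rfl⟩
  rw [transitionCount_reverse_apply]
  exact hle a.symm

section LeadingTerm

variable {k : Type v} [Field k] {m : MonomialOrder.{u, w} G.Dart} {x : V} {ω : G.Walk x x}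

theorem degree_binomial
    (h : m.toSyn (transitionCount ω.reverse) < m.toSyn (transitionCount ω)) :
    m.degree (binomial k ω) = transitionCount ω := by
  classical
  rw [binomial, pathMonomial, pathMonomial, m.degree_sub_of_lt]
  · simp [MonomialOrder.degree_monomial]
  · simpa [MonomialOrder.degree_monomial] using h

theorem leadingCoeff_binomial
    (h : m.toSyn (transitionCount ω.reverse) < m.toSyn (transitionCount ω)) :
    m.leadingCoeff (binomial k ω) = 1 := by
  classical
  rw [binomial, pathMonomial, pathMonomial, m.leadingCoeff_sub_of_lt]
  · simp
  · simpa [MonomialOrder.degree_monomial] using h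

end LeadingTerm

/-- The leading term of every element of the K-ideal is divisible by the leading term of an
oriented cycle binomial. -/
theorem leadingTerm_mem_span_orientedCycleBinomials [Finite V] {k : Type v} [Field k]
    (m : MonomialOrder.{u, w} G.Dart) {f : MvPolynomial G.Dart k} (hf : f ∈ kIdeal k G) :
    m.leadingTerm f ∈ Ideal.span (m.leadingTerm '' orientedCycleBinomials k G m) := by
  by_cases hf0 : f = 0
  · simp [hf0]
  obtain ⟨v, hv, hne, hdeg⟩ :=
    exists_mem_support_ne_of_mem_kIdeal hf (m.degree_mem_support hf0)
  have hlt : m.toSyn v < m.toSyn (m.degree f) :=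
    (m.le_degree hv).lt_of_ne fun h => hne (m.toSyn.injective h)
  obtain ⟨x, ω, hω, hrev, hle⟩ := exists_isElementary_toSyn_lt m hdeg hlt
  have hmem := Ideal.mul_mem_left _ (monomial (m.degree f - transitionCount ω) (m.leadingCoeff f))
    (Ideal.subset_span (s := m.leadingTerm '' orientedCycleBinomials k G m)
      ⟨_, ⟨x, ω, hω, hrev, rfl⟩, rfl⟩)
  rwa [show m.leadingTerm (binomial k ω) = monomial _ _ from rfl, degree_binomial hrev,
    leadingCoeff_binomial hrev, monomial_mul, mul_one,
    tsub_add_cancel_of_le (hle.trans tsub_le_self)] at hmem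

/-- Every set of cycle binomials that contains the oriented ones is a Gröbner basis. -/
theorem isGroebnerBasis_of_orientedCycleBinomials_subset [Finite V] {k : Type v} [Field k]
    (m : MonomialOrder.{u, w} G.Dart) {B : Set (MvPolynomial G.Dart k)}
    (hO : orientedCycleBinomials k G m ⊆ B) (hB : B ⊆ cycleBinomials k G) :
    IsGroebnerBasis m B (kIdeal k G) := by
  have hI := hB.trans (cycleBinomials_subset_kIdeal k)
  refine ⟨(finite_cycleBinomials k G).subset hB, hI,
    le_antisymm (Ideal.span_mono (Set.image_mono hI)) (Ideal.span_le.2 ?_)⟩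
  rintro _ ⟨f, hf, rfl⟩
  exact Ideal.span_mono (Set.image_mono hO) (leadingTerm_mem_span_orientedCycleBinomials m hf)

/-! ### Reducedness -/

theorem mem_end_of_mem_support {p : V → Prop} {x y : V} (ω : G.Walk x y)
    (h : ∀ a ∈ ω.darts, p a.fst → p a.snd) {z : V} (hz : z ∈ ω.support) (hpz : p z) : p y := by
  induction ω generalizing z with
  | nil => simp_all
  | cons hadj ω ih =>
    rw [Walk.darts_cons, List.forall_mem_cons] at h
    rw [Walk.support_cons, List.mem_cons] at hz
    rcases hz with rfl | hz
    · exact ih h.2 ω.start_mem_support (h.1 hpz)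
    · exact ih h.2 hz hpz

/-- A set of vertices that is closed under the steps of a closed walk and meets the walk contains
all its vertices. -/
theorem forall_mem_support_of_closed {p : V → Prop} {x : V} (ω : G.Walk x x)
    (h : ∀ a ∈ ω.darts, p a.fst → p a.snd) {z : V} (hz : z ∈ ω.support) (hpz : p z) :
    ∀ y ∈ ω.support, p y := by
  classical
  intro y hy
  refine mem_end_of_mem_support (ω.takeUntil y hy)
    (fun a ha => h a (ω.darts_takeUntil_subset_darts hy ha)) (Walk.start_mem_support _)
    (mem_end_of_mem_support ω h hz hpz)

/-- Cycles are minimal: a nonempty closed walk `ω'` inside a cycle `ω` is all of `ω`. Going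
backwards along `ω` from a vertex of `ω'`, the arc of `ω` that enters this vertex is the only one,
hence the one that `ω'` uses. -/
theorem IsElementary.transitionCount_eq_of_le {x y : V} {ω : G.Walk x x} {ω' : G.Walk y y}
    (hω : IsElementary ω) (hω' : ω'.length ≠ 0)
    (hle : transitionCount ω' ≤ transitionCount ω) :
    transitionCount ω' = transitionCount ω := by
  have hsub : ∀ a ∈ ω'.darts, a ∈ ω.darts := fun a ha =>
    transitionCount_pos_iff.1 ((transitionCount_pos_iff.2 ha).trans_le (hle a))
  have hsnd : ∀ z ∈ ω'.support, ∃ b ∈ ω'.darts, b.snd = z := by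
    intro z hz
    have hmem : z ∈ ω'.support.tail := by
      rcases (Walk.mem_support_iff _).1 hz with rfl | hz
      · exact Walk.end_mem_tail_support (by rwa [← Walk.length_eq_zero_iff])
      · exact hz
    rwa [← Walk.map_snd_darts, List.mem_map] at hmem
  have hinj : ∀ a ∈ ω.darts, ∀ b ∈ ω.darts, a.snd = b.snd → a = b := by
    have := hω.2
    rw [← Walk.map_snd_darts] at this
    exact fun a ha b hb => List.inj_on_of_nodup_map this ha hb
  have henter : ∀ a ∈ ω.darts, a.snd ∈ ω'.support → a ∈ ω'.darts := by
    intro a ha hmem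
    obtain ⟨b, hb, hba⟩ := hsnd _ hmem
    rwa [hinj a ha b (hsub b hb) hba.symm]
  have hall : ∀ z ∈ ω.reverse.support, z ∈ ω'.support := by
    obtain ⟨b, hb, hby⟩ := hsnd y ω'.start_mem_support
    refine forall_mem_support_of_closed ω.reverse (p := (· ∈ ω'.support)) ?_ (z := y) ?_
      ω'.start_mem_support
    · intro a ha hmem
      rw [Walk.mem_darts_reverse] at ha
      exact ω'.dart_fst_mem_support_of_mem_darts (henter a.symm ha hmem)
    · rw [Walk.support_reverse, List.mem_reverse, ← hby]
      exact ω.dart_snd_mem_support_of_mem_darts (hsub b hb)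
  refine le_antisymm hle ((transitionCount_le_iff_of_nodup hω.darts_nodup).2 fun a ha => ?_)
  refine transitionCount_pos_iff.2 (henter a ha (hall _ ?_))
  rw [Walk.support_reverse, List.mem_reverse]
  exact ω.dart_snd_mem_support_of_mem_darts ha

theorem transitionCount_reverse_le_reverse {x y z t : V} {ω : G.Walk x y} {ω' : G.Walk z t}
    (h : transitionCount ω' ≤ transitionCount ω) :
    transitionCount ω'.reverse ≤ transitionCount ω.reverse := fun a => by
  rw [transitionCount_reverse_apply, transitionCount_reverse_apply]
  exact h a.symm

theorem isReducedGroebnerBasis_orientedCycleBinomials [Finite V] (k : Type v) [Field k]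
    (m : MonomialOrder.{u, w} G.Dart) :
    IsReducedGroebnerBasis m (orientedCycleBinomials k G m) (kIdeal k G) := by
  classical
  refine ⟨isGroebnerBasis_of_orientedCycleBinomials_subset m subset_rfl
    (orientedCycleBinomials_subset_cycleBinomials k m), ?_, ?_⟩
  · rintro _ ⟨x, ω, -, hrev, rfl⟩
    exact leadingCoeff_binomial hrev
  rintro _ ⟨x, ω, hω, hrev, rfl⟩ _ ⟨y, ω', hω', hrev', rfl⟩ hne c hc hle
  rw [degree_binomial hrev'] at hle
  have hcount : ∀ {z t : V} {p : G.Walk z z} {q : G.Walk t t},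
      transitionCount p ≤ transitionCount q → transitionCount q ≤ transitionCount p →
      transitionCount p.reverse = transitionCount q.reverse := fun h1 h2 =>
    le_antisymm (transitionCount_reverse_le_reverse h1) (transitionCount_reverse_le_reverse h2)
  rcases Finset.mem_union.1 (support_sub _ _ _ hc) with hc | hc <;>
    obtain rfl := Finset.mem_singleton.1 (support_monomial_subset hc)
  · have heq := hω.transitionCount_eq_of_le hω'.1 hle
    exact hne (by rw [binomial, binomial, pathMonomial, pathMonomial, pathMonomial, pathMonomial,
      heq, hcount heq.le heq.ge])
  · -- A cycle cannot have the same exponents as the reverse of another one if both are larger than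
    -- their reverses.
    have hle' := transitionCount_reverse_le_reverse hle
    rw [Walk.reverse_reverse] at hle'
    have heq := hω.transitionCount_eq_of_le ((Walk.length_reverse ω').trans_ne hω'.1) hle'
    have heq' := hcount heq.le heq.ge
    rw [Walk.reverse_reverse] at heq'
    rw [heq, heq'] at hrev'
    exact hrev.asymm hrev'

end

end KolmogorovIdeal

theorem mainTheorem3 {V : Type u} [Finite V] (G : SimpleGraph V) (hG : G.Connected)
    (k : Type v) [Field k] :
    KolmogorovIdeal.kIdeal k G = Ideal.span (KolmogorovIdeal.cycleBinomials k G) ∧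
    ∀ m : MonomialOrder.{u, w} G.Dart,
      KolmogorovIdeal.IsGroebnerBasis m (KolmogorovIdeal.cycleBinomials k G)
        (KolmogorovIdeal.kIdeal k G) ∧
      KolmogorovIdeal.IsReducedGroebnerBasis m (KolmogorovIdeal.orientedCycleBinomials k G m)
        (KolmogorovIdeal.kIdeal k G) := by
  refine ⟨KolmogorovIdeal.kIdeal_eq_span_cycleBinomials k, fun m => ⟨?_, ?_⟩⟩
  · exact KolmogorovIdeal.isGroebnerBasis_of_orientedCycleBinomials_subset m
      (KolmogorovIdeal.orientedCycleBinomials_subset_cycleBinomials k m) subset_rfl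
  · exact KolmogorovIdeal.isReducedGroebnerBasis_orientedCycleBinomials k m
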